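/- **Control-dependent switching mean-field-type game.** Let $T>0$, let $\mathcal I$ be a finite set of decision-makers and $\mathcal S$ a finite set of regimes. *Data.* For $i,j\in\mathcal I$ and $s,s'\in\mathcal S$ let $r_i,\bar r_i,\epsilon_i,b_{2jss'},\bar b_{2jss'},\bar b_{1jss'},\bar b_{ojss'}$ be real coefficients which are continuous functions of $t\in[0,T]$ ($r_i,\bar r_i,\epsilon_i$ may depend on the regime $s$), with $r_i,\bar r_i>0$, and let $q_i(T,s)$ be real numbers. Let also $\Gamma_{jss's''}$ be real continuous functions on $[0,T]$, the second moments of the random coefficients $b_1$ below. For each of the families $b_2,\bar b_2,\bar b_1,\bar b_o,b_1$ the diagonal entry is $b_{jss}=-\sum_{s'\ne s}b_{jss'}$. *Plays.* A play on $[t_0,T]$ started in the regime $s_0$ consists of a filtered probability space $(\Omega,\mathbb F,P)$ and, on $[t_0,T]$, of $\mathbb F$-adapted measurable processes: a càdlàg $\mathcal S$-valued regime process $s$ with $s(t_0)=s_0$ a.s., random coefficients $b_{1jss'}$, and controls $u_j$, the latter two in $L^2([t_0,T]\times\Omega)$. Write $\mathcal F^s_t=\sigma(s(t'):t_0\le t'\le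 t)$ and $\bar u_j(t)=E[u_j(t)\mid\mathcal F^s_t]$ (a jointly measurable version). The random coefficients satisfy, for almost every $t$, $$E[b_{1jss'}(t)]=0,\qquad E[b_{1jss'}(t)b_{1jss''}(t)\mid\mathcal F^s_t]=\Gamma_{jss's''}(t)\ \text{ a.s.}$$ The process $s$ has, with respect to $\mathbb F$, the switching rates $$\tilde q_{ss'}(u)=\sum_{j}\big[b_{2jss'}(u_j-\bar u_j)^2+\bar b_{2jss'}\bar u_j^2+b_{1jss'}(u_j-\bar u_j)+\bar b_{1jss'}\bar u_j+\bar b_{ojss'}\big],$$ that is, $\tilde q_{s(t)s'}(u(t))\ge 0$ for $s'\neq s(t)$, a.e., and $f(s(t))-\int_{t_0}^t\sum_{s'}f(s')\tilde q_{s(t')s'}(u(t'))\,dt'$ is an $\mathbb F$-martingale on $[t_0,T]$ for every $f:\mathcal S\to\mathbb R$. The expected cost of $i$ is $$E[L_i]=E\Big[q_i(T,s(T))+\int_{t_0}^T r_i(u_i-\bar u_i)^2+\bar r_i\bar u_i^2+\epsilon_i\bar u_i\,dt\Big].$$ Given a profile of feedback rules (functions of $t$, $s(t)$ and $b_{1j}(t)$),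 we say that decision-maker $j$ *plays* it if $u_j$ is given by $j$'s rule for almost every $(t,\omega)$ and $E[b_{1jss'}(t)\mid\mathcal F^s_t]=0$ a.s. for all $s,s'$ and almost every $t$. An *equilibrium play* is a play in which every $j$ plays the profile; a *deviation of $i$* is a play in which every $j\ne i$ plays it, while $u_i$ is an arbitrary admissible (adapted, $L^2$) control. *Proposition.* For functions $V_i$ on $[0,T]\times\mathcal S$ put $D_i=r_i+\sum_{s'}V_i(t,s')b_{2iss'}$, $\bar D_i=\bar r_i+\sum_{s'}V_i(t,s')\bar b_{2iss'}$, $\bar N_i=\epsilon_i+\sum_{s'}V_i(t,s')\bar b_{1iss'}$ and $M^{j}_{ik}=\sum_{s',s''}V_i(t,s')V_k(t,s'')\Gamma_{jss's''}$, which is $E\big[(\sum_{s'}V_i(t,s')b_{1jss'})(\sum_{s'}V_k(t,s')b_{1jss'})\big]$. Suppose that $V$ is differentiable in $t\in[0,T]$, that $D_i>0$ and $\bar D_i>0$ on $[0,T]\times\mathcal S$ for all $i$, and that $$\begin{aligned}\dot V_i&+\sum_{s'}V_i(t,s')\sum_j\bar b_{ojss'}-\frac14\frac{M^i_{ii}}{D_i}-\frac14\frac{\bar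 N_i^2}{\bar D_i}\\&+\frac14\sum_{j\ne i}\Big[\sum_{s'}V_i(t,s')b_{2jss'}\Big]\frac{M^j_{jj}}{D_j^2}+\frac14\sum_{j\ne i}\Big[\sum_{s'}V_i(t,s')\bar b_{2jss'}\Big]\Big(\frac{\bar N_j}{\bar D_j}\Big)^2\\&-\frac12\sum_{j\ne i}\frac{M^j_{ij}}{D_j}-\frac12\sum_{j\ne i}\Big[\sum_{s'}V_i(t,s')\bar b_{1jss'}\Big]\frac{\bar N_j}{\bar D_j}=0,\qquad V_i(T,s)=q_i(T,s).\end{aligned}$$ Then the profile $$u_i^*(t)=-\sum_{s\in\mathcal S}1_{\{s(t)=s\}}\Big(\frac12\,\frac{\sum_{s'}V_i(t,s')b_{1iss'}(t)}{D_i(t,s)}+\frac12\,\frac{\bar N_i(t,s)}{\bar D_i(t,s)}\Big)$$ is a Nash equilibrium from every initial time $t_0\in[0,T]$ and regime $s_0$ (the cost of $i$ in any equilibrium play is at most its cost in any deviation of $i$), and the equilibrium cost of $i$, that is, its cost in any equilibrium play from $(t_0,s_0)$, is $V_i(t_0,s_0)$. Moreover every deviation of $i$ from $(t_0,s_0)$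 costs $i$ at least $V_i(t_0,s_0)$, and it can cost exactly $V_i(t_0,s_0)$ only if $u_i=u_i^*$ for almost every $(t,\omega)$. -/

import Mathlib

open MeasureTheory ProbabilityTheory Set Filter Topology

universe w

/-- Data of a mean-field-type game on a finite set `S` of regimes with a finite set `I` of
decision-makers.  All coefficients may depend on time and on the regime.  In `b j t s s'` the
regime `s` is the one that is left and `s'` the one that is entered; the diagonal entries are fixed
by zero row sums, so that the matrix of switching rates is conservative.
The coefficients `b₁` of `u_j - ū_j` are random and belong to a play of the game (see `Play`);
only their second moments `cov j t s s' s'' = E[b₁ j t s s' * b₁ j t s s'']` are data. -/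
structure SwitchingGame (I S : Type*) [Fintype I] [Fintype S] where
  T : ℝ
  T_pos : 0 < T
  r : I → ℝ → S → ℝ
  rbar : I → ℝ → S → ℝ
  eps : I → ℝ → S → ℝ
  qT : I → S → ℝ
  b₂ : I → ℝ → S → S → ℝ
  b₂bar : I → ℝ → S → S → ℝ
  b₁bar : I → ℝ → S → S → ℝ
  b₀bar : I → ℝ → S → S → ℝ
  cov : I → ℝ → S → S → S → ℝ
  r_cont : ∀ i x, ContinuousOn (fun t => r i t x) (Icc 0 T)
  rbar_cont : ∀ i x, ContinuousOn (fun t => rbar i t x) (Icc 0 T)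
  eps_cont : ∀ i x, ContinuousOn (fun t => eps i t x) (Icc 0 T)
  b₂_cont : ∀ j x y, ContinuousOn (fun t => b₂ j t x y) (Icc 0 T)
  b₂bar_cont : ∀ j x y, ContinuousOn (fun t => b₂bar j t x y) (Icc 0 T)
  b₁bar_cont : ∀ j x y, ContinuousOn (fun t => b₁bar j t x y) (Icc 0 T)
  b₀bar_cont : ∀ j x y, ContinuousOn (fun t => b₀bar j t x y) (Icc 0 T)
  cov_cont : ∀ j x y z, ContinuousOn (fun t => cov j t x y z) (Icc 0 T)
  b₂_row : ∀ j t x, ∑ y, b₂ j t x y = 0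
  b₂bar_row : ∀ j t x, ∑ y, b₂bar j t x y = 0
  b₁bar_row : ∀ j t x, ∑ y, b₁bar j t x y = 0
  b₀bar_row : ∀ j t x, ∑ y, b₀bar j t x y = 0

namespace SwitchingGame

variable {I S : Type*} [Fintype I] [Fintype S]

/-- The switching rate from `x` to `y` at time `t` when the coefficients of the fluctuations of the
controls are `b₁`, the controls are `u` and their conditional means are `ubar`. -/
def rate (G : SwitchingGame I S) (b₁ : I → S → S → ℝ) (u ubar : I → ℝ) (t : ℝ) (x y : S) : ℝ :=
  ∑ j, (G.b₂ j t x y * (u j - ubar j) ^ 2 + G.b₂bar j t x y * ubar j ^ 2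
    + b₁ j x y * (u j - ubar j) + G.b₁bar j t x y * ubar j + G.b₀bar j t x y)

/-- The running cost of decision-maker `i`. -/
def runningCost (G : SwitchingGame I S) (i : I) (t : ℝ) (x : S) (ui ubari : ℝ) : ℝ :=
  G.r i t x * (ui - ubari) ^ 2 + G.rbar i t x * ubari ^ 2 + G.eps i t x * ubari

end SwitchingGame

/-- The information generated by the regime process on `[t₀, t]` (the common noise). -/
abbrev regimeInfo {S Ω : Type*} (t₀ : ℝ) (s : ℝ → Ω → S) (t : ℝ) : MeasurableSpace Ω :=
  ⨆ r ∈ Icc t₀ t, MeasurableSpace.comap (s r) ⊤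

/-- A play of the game on `[t₀, T]`, started in the regime `s₀`, on the probability space `(Ω, P)`:
a filtration, an adapted càdlàg regime process `s`, adapted random coefficients `b₁`, adapted
square-integrable controls `u` with their conditional means `ubar = E[u | σ(s)]`, such that `s` has
the controlled switching rates (as a martingale problem). -/
structure Play {I S : Type*} [Fintype I] [Fintype S] (G : SwitchingGame I S) (t₀ : ℝ) (s₀ : S)
    {Ω : Type*} [mΩ : MeasurableSpace Ω] (P : Measure Ω) where
  ℱ : Filtration ℝ mΩ
  s : ℝ → Ω → S
  b₁ : I → ℝ → S → S → Ω → ℝ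
  u : I → ℝ → Ω → ℝ
  ubar : I → ℝ → Ω → ℝ
  -- the regime process
  s_meas : ∀ x, MeasurableSet {z : ℝ × Ω | s z.1 z.2 = x}
  s_adapted : ∀ t ∈ Icc t₀ G.T, ∀ x, MeasurableSet[ℱ t] {ω | s t ω = x}
  s_right : ∀ ω, ∀ t ∈ Ico t₀ G.T, ∀ᶠ t' in 𝓝[>] t, s t' ω = s t ω
  s_left : ∀ ω, ∀ t ∈ Ioc t₀ G.T, ∃ x, ∀ᶠ t' in 𝓝[<] t, s t' ω = x
  s_init : ∀ᵐ ω ∂P, s t₀ ω = s₀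
  -- the random coefficients: centred, with nonrandom conditional second moments
  b₁_meas : ∀ j x y, Measurable (fun z : ℝ × Ω => b₁ j z.1 x y z.2)
  b₁_adapted : ∀ j x y, ∀ t ∈ Icc t₀ G.T, Measurable[ℱ t] (b₁ j t x y)
  b₁_sq : ∀ j x y, MemLp (fun z : ℝ × Ω => b₁ j z.1 x y z.2) 2
    ((volume.restrict (Icc t₀ G.T)).prod P)
  b₁_row : ∀ j t x ω, ∑ y, b₁ j t x y ω = 0
  b₁_mean : ∀ j x y, ∀ᵐ t ∂(volume.restrict (Icc t₀ G.T)), ∫ ω, b₁ j t x y ω ∂P = 0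
  b₁_cov : ∀ j x y z, ∀ᵐ t ∂(volume.restrict (Icc t₀ G.T)),
    P[(fun ω => b₁ j t x y ω * b₁ j t x z ω) | regimeInfo t₀ s t] =ᵐ[P] fun _ => G.cov j t x y z
  -- the controls and their conditional means
  u_meas : ∀ j, Measurable (fun z : ℝ × Ω => u j z.1 z.2)
  u_adapted : ∀ j, ∀ t ∈ Icc t₀ G.T, Measurable[ℱ t] (u j t)
  u_sq : ∀ j, MemLp (fun z : ℝ × Ω => u j z.1 z.2) 2 ((volume.restrict (Icc t₀ G.T)).prod P)
  ubar_meas : ∀ j, Measurable (fun z : ℝ × Ω => ubar j z.1 z.2)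
  ubar_sq : ∀ j, MemLp (fun z : ℝ × Ω => ubar j z.1 z.2) 2
    ((volume.restrict (Icc t₀ G.T)).prod P)
  ubar_eq : ∀ j, ∀ᵐ t ∂(volume.restrict (Icc t₀ G.T)),
    ubar j t =ᵐ[P] P[u j t | regimeInfo t₀ s t]
  -- the switching rates
  rate_nonneg : ∀ᵐ z ∂((volume.restrict (Icc t₀ G.T)).prod P), ∀ y, y ≠ s z.1 z.2 →
    0 ≤ G.rate (fun j x y => b₁ j z.1 x y z.2) (fun j => u j z.1 z.2) (fun j => ubar j z.1 z.2)
      z.1 (s z.1 z.2) y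
  martingale : ∀ f : S → ℝ, ∀ a b, t₀ ≤ a → a ≤ b → b ≤ G.T →
    P[(fun ω => f (s b ω) - f (s a ω) - ∫ t in a..b, ∑ y, f y *
        G.rate (fun j x y => b₁ j t x y ω) (fun j => u j t ω) (fun j => ubar j t ω) t (s t ω) y)
      | ℱ a] =ᵐ[P] fun _ => 0

/-- A profile of feedback strategies: `φ j t x β` is the action of `j` at time `t` in the regime `x`
when the current values of the random coefficients `b₁ j t` are `β`. -/
abbrev FeedbackProfile (I S : Type*) := I → ℝ → S → (S → S → ℝ) → ℝ

namespace Play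

variable {I S : Type*} [Fintype I] [Fintype S] {G : SwitchingGame I S} {t₀ : ℝ} {s₀ : S}
  {Ω : Type*} [MeasurableSpace Ω] {P : Measure Ω}

/-- The expected cost `E[L_i]` on `[t₀, T]`. -/
noncomputable def cost (p : Play G t₀ s₀ P) (i : I) : ℝ :=
  ∫ ω, (G.qT i (p.s G.T ω)
    + ∫ t in t₀..G.T, G.runningCost i t (p.s t ω) (p.u i t ω) (p.ubar i t ω)) ∂P

/-- Decision-maker `j` uses the feedback `φ j`. -/
def Follows (p : Play G t₀ s₀ P) (φ : FeedbackProfile I S) (j : I) : Prop :=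
  ∀ᵐ z ∂((volume.restrict (Icc t₀ G.T)).prod P),
    p.u j z.1 z.2 = φ j z.1 (p.s z.1 z.2) (fun x y => p.b₁ j z.1 x y z.2)

/-- The random coefficients of `j` are centred given the observed regimes. -/
def Centred (p : Play G t₀ s₀ P) (j : I) : Prop :=
  ∀ x y, ∀ᵐ t ∂(volume.restrict (Icc t₀ G.T)),
    P[p.b₁ j t x y | regimeInfo t₀ p.s t] =ᵐ[P] fun _ => 0

/-- All decision-makers use `φ`. -/
def IsPlayOf (p : Play G t₀ s₀ P) (φ : FeedbackProfile I S) : Prop :=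
  ∀ j, p.Centred j ∧ p.Follows φ j

/-- All decision-makers except possibly `i` use `φ`; the control of `i` is an arbitrary admissible
process. -/
def IsDeviationFrom (p : Play G t₀ s₀ P) (φ : FeedbackProfile I S) (i : I) : Prop :=
  ∀ j, j ≠ i → p.Centred j ∧ p.Follows φ j

end Play

namespace SwitchingGame

variable {I S : Type*} [Fintype I] [Fintype S]

/-- Nash equilibrium, from every initial time and regime: no decision-maker lowers the expected
cost by a unilateral deviation. -/
def IsNashEquilibrium (G : SwitchingGame I S) (φ : FeedbackProfile I S) : Prop :=
  ∀ (i : I), ∀ t₀ ∈ Icc 0 G.T, ∀ (s₀ : S)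
    (Ω : Type w) [MeasurableSpace Ω] (P : Measure Ω) [IsProbabilityMeasure P] (p : Play G t₀ s₀ P)
    (Ω' : Type w) [MeasurableSpace Ω'] (P' : Measure Ω') [IsProbabilityMeasure P']
    (p' : Play G t₀ s₀ P'),
    p.IsPlayOf φ → p'.IsDeviationFrom φ i → p.cost i ≤ p'.cost i

/-- `V i t s` is the expected cost of `i` from time `t` and regime `s` on, when all use `φ`. -/
def IsCostOf (G : SwitchingGame I S) (φ : FeedbackProfile I S) (V : I → ℝ → S → ℝ) : Prop :=
  ∀ (i : I), ∀ t₀ ∈ Icc 0 G.T, ∀ (s₀ : S)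
    (Ω : Type w) [MeasurableSpace Ω] (P : Measure Ω) [IsProbabilityMeasure P] (p : Play G t₀ s₀ P),
    p.IsPlayOf φ → p.cost i = V i t₀ s₀

/-- Against the other components of `φ`, no play costs `i` less than `V i`, and only the use of
`φ i` can cost `V i`. -/
def IsStrictBestResponseCost (G : SwitchingGame I S) (φ : FeedbackProfile I S)
    (V : I → ℝ → S → ℝ) : Prop :=
  ∀ (i : I), ∀ t₀ ∈ Icc 0 G.T, ∀ (s₀ : S)
    (Ω : Type w) [MeasurableSpace Ω] (P : Measure Ω) [IsProbabilityMeasure P] (p : Play G t₀ s₀ P),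
    p.IsDeviationFrom φ i →
      V i t₀ s₀ ≤ p.cost i ∧ (p.cost i = V i t₀ s₀ → p.Follows φ i)

/-- `r_i + ∑_{s'} V_i(t,s') b_{2iss'}`. -/
def den (G : SwitchingGame I S) (V : I → ℝ → S → ℝ) (i : I) (t : ℝ) (x : S) : ℝ :=
  G.r i t x + ∑ y, V i t y * G.b₂ i t x y

/-- `r̄_i + ∑_{s'} V_i(t,s') b̄_{2iss'}`. -/
def denBar (G : SwitchingGame I S) (V : I → ℝ → S → ℝ) (i : I) (t : ℝ) (x : S) : ℝ :=
  G.rbar i t x + ∑ y, V i t y * G.b₂bar i t x y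

/-- `ε_i + ∑_{s'} V_i(t,s') b̄_{1iss'}`. -/
def numBar (G : SwitchingGame I S) (V : I → ℝ → S → ℝ) (i : I) (t : ℝ) (x : S) : ℝ :=
  G.eps i t x + ∑ y, V i t y * G.b₁bar i t x y

/-- The second moment `E[(∑_{s'} V_i(t,s') b_{1jss'}) (∑_{s'} V_k(t,s') b_{1jss'})]`. -/
def mom (G : SwitchingGame I S) (V : I → ℝ → S → ℝ) (j i k : I) (t : ℝ) (x : S) : ℝ :=
  ∑ y, ∑ z, V i t y * V k t z * G.cov j t x y z

/-- The strategy profile `u*` determined by `V`. -/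
noncomputable def equilibriumProfile (G : SwitchingGame I S) (V : I → ℝ → S → ℝ) :
    FeedbackProfile I S := fun i t x β =>
  -(1 / 2 * ((∑ y, V i t y * β x y) / G.den V i t x))
    - 1 / 2 * (G.numBar V i t x / G.denBar V i t x)

/-- The left-hand side of the differential system for `V`, without the term `dV_i/dt`. -/
noncomputable def odeTerm [DecidableEq I] (G : SwitchingGame I S) (V : I → ℝ → S → ℝ)
    (i : I) (t : ℝ) (x : S) : ℝ :=
  (∑ y, V i t y * ∑ j, G.b₀bar j t x y)
    - 1 / 4 * (G.mom V i i i t x / G.den V i t x)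
    - 1 / 4 * (G.numBar V i t x ^ 2 / G.denBar V i t x)
    + 1 / 4 * ∑ j ∈ Finset.univ.erase i,
        (∑ y, V i t y * G.b₂ j t x y) * (G.mom V j j j t x / G.den V j t x ^ 2)
    + 1 / 4 * ∑ j ∈ Finset.univ.erase i,
        (∑ y, V i t y * G.b₂bar j t x y) * (G.numBar V j t x / G.denBar V j t x) ^ 2
    - 1 / 2 * ∑ j ∈ Finset.univ.erase i, G.mom V j i j t x / G.den V j t x
    - 1 / 2 * ∑ j ∈ Finset.univ.erase i,
        (∑ y, V i t y * G.b₁bar j t x y) * (G.numBar V j t x / G.denBar V j t x)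

/-- `V` is a classical solution on `[0, T]` of the differential system with terminal data `q_i(T,·)`. -/
def SolvesSystem [DecidableEq I] (G : SwitchingGame I S) (V : I → ℝ → S → ℝ) : Prop :=
  (∀ i, ∀ t ∈ Icc 0 G.T, ∀ x, ∃ V' : ℝ,
      HasDerivWithinAt (fun t => V i t x) V' (Icc 0 G.T) t ∧ V' + G.odeTerm V i t x = 0) ∧
    ∀ i x, V i G.T x = G.qT i x

end SwitchingGame

/-! This is a verification argument with `V i t (s t)` as test function. By Dynkin's formula
(`Play.integral_terminal_sub_eq`) and the differential system, cost minus value is, in any play, the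
mean time integral of the drift of `V i` plus running cost minus `odeTerm` (`cost_sub_value_eq`).
Dynkin's formula needs only the one-time laws of the regime: the martingale problem, in expectation,
shows that `P(s t = y)` is a primitive of the mean rate into `y`, and integration by parts in `t`
does the rest.

The integrand is separately quadratic in `u_i - ū_i` and `ū_i`. If the others play the profile,
centring the random coefficients given the regimes identifies their `ū_j` with the nonrandom part of
the feedback (`ubar_eq_of_follows`). Completing both squares of `i` then leaves a nonnegative
`penalty` and terms `c(s t) (B_jk B_jl - M^j_kl)`, where `B_jk` is `weighted V j k`
(`hamiltonian_sub_odeTerm`). The latter have mean zero, because the conditional second moments given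
the regimes are `cov` (`integral_weighted_mul_sub_mom`).

Hence a deviation costs the value plus the integrated mean penalty. The penalty is nonnegative,
vanishes almost everywhere in an equilibrium play, and forces the feedback of `i` wherever it
vanishes. -/

/-- The product rule for primitives of integrable functions. -/
theorem IntervalIntegrable.mul_sub_mul_eq_integral {f g f' g' : ℝ → ℝ} {a b : ℝ}
    (hf' : IntervalIntegrable f' volume a b) (hg' : IntervalIntegrable g' volume a b)
    (hf : ∀ t ∈ uIcc a b, f t = f a + ∫ r in a..t, f' r)
    (hg : ∀ t ∈ uIcc a b, g t = g a + ∫ r in a..t, g' r) :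
    f b * g b - f a * g a = ∫ t in a..b, (f' t * g t + f t * g' t) := by
  -- `f` and `g` are prescribed only on the interval, so the differentiation is done on the
  -- primitives, which are defined on the whole line.
  have hac : ∀ {h h' : ℝ → ℝ}, IntervalIntegrable h' volume a b →
      AbsolutelyContinuousOnInterval (fun t => h a + ∫ r in a..t, h' r) a b := by
    intro h h' hh
    have hc : AbsolutelyContinuousOnInterval (fun _ : ℝ => h a) a b :=
      ((LipschitzWith.const (h a)).lipschitzOnWith (s := uIcc a b)).absolutelyContinuousOnInterval
    exact hc.add (hh.absolutelyContinuousOnInterval_intervalIntegral left_mem_uIcc)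
  have key := (hac (h := f) hf').integral_deriv_mul_eq_sub (hac (h := g) hg')
  simp only [intervalIntegral.integral_same, add_zero] at key
  rw [← hf b right_mem_uIcc, ← hg b right_mem_uIcc] at key
  rw [← key]
  apply intervalIntegral.integral_congr_ae
  filter_upwards [hf'.ae_hasDerivAt_integral, hg'.ae_hasDerivAt_integral] with t h1 h2 ht
  have ht' : t ∈ uIcc a b := uIoc_subset_uIcc ht
  have e1 := ((h1 ht' a left_mem_uIcc).const_add (f a)).deriv
  have e2 := ((h2 ht' a left_mem_uIcc).const_add (g a)).deriv
  rw [e1, e2, ← hf t ht', ← hg t ht']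

/-- Interior points of `[a, t]` are interior to `[c, b]`, where the one-sided derivative is a true
one. The application has `c = 0` and `a = t₀`. -/
theorem ContinuousOn.eq_add_integral_of_hasDerivWithinAt {f f' : ℝ → ℝ} {a b c : ℝ}
    (hca : c ≤ a)
    (hf : ∀ t ∈ Icc c b, HasDerivWithinAt f (f' t) (Icc c b) t) (hf' : ContinuousOn f' (Icc c b)) :
    ∀ t ∈ Icc a b, f t = f a + ∫ r in a..t, f' r := by
  intro t ht
  have hsub : Icc a t ⊆ Icc c b := Icc_subset_Icc hca ht.2
  rw [intervalIntegral.integral_eq_sub_of_hasDerivAt_of_le ht.1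
    (fun r hr => (hf r (hsub hr)).continuousWithinAt.mono hsub)
    (fun r hr => (hf r (hsub (Ioo_subset_Icc_self hr))).hasDerivAt
      (Icc_mem_nhds (hca.trans_lt hr.1) (hr.2.trans_le ht.2)))
    ((hf'.mono hsub).intervalIntegrable_of_Icc ht.1)]
  ring

/-! ### Random functions evaluated at a finite-valued map. -/

section Fibres

variable {S α : Type*} [Fintype S] {σ : α → S}

/-- Reduces statements at the random regime to fixed regimes, using only measurability of the fibres
and no σ-algebra on `S`. -/
theorem eq_sum_indicator_fibre (F : S → α → ℝ) :
    (fun a => F (σ a) a) = fun a => ∑ x, {a | σ a = x}.indicator (F x) a := by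
  classical
  funext a
  simp [indicator_apply]

variable [MeasurableSpace α] {μ : Measure α}

theorem integrable_comp_fibre (hσ : ∀ x, MeasurableSet {a | σ a = x}) {F : S → α → ℝ}
    (hF : ∀ x, Integrable (F x) μ) : Integrable (fun a => F (σ a) a) μ := by
  rw [eq_sum_indicator_fibre]
  exact integrable_finsetSum _ fun x _ => (hF x).indicator (hσ x)

theorem aemeasurable_comp_fibre (hσ : ∀ x, MeasurableSet {a | σ a = x}) {F : S → α → ℝ}
    (hF : ∀ x, AEMeasurable (F x) μ) : AEMeasurable (fun a => F (σ a) a) μ := by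
  rw [eq_sum_indicator_fibre]
  exact Finset.aemeasurable_fun_sum _ fun x _ => (hF x).indicator (hσ x)

theorem integral_comp_fibre (hσ : ∀ x, MeasurableSet {a | σ a = x}) {F : S → α → ℝ}
    (hF : ∀ x, Integrable (F x) μ) :
    ∫ a, F (σ a) a ∂μ = ∑ x, ∫ a in {a | σ a = x}, F x a ∂μ := by
  rw [eq_sum_indicator_fibre, integral_finsetSum _ fun x _ => (hF x).indicator (hσ x)]
  exact Finset.sum_congr rfl fun x _ => integral_indicator (hσ x)

end Fibres

/-- Equality almost everywhere on a product can be checked on almost every section. -/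
theorem AEMeasurable.ae_eq_prod_of_ae_ae {α β : Type*} [MeasurableSpace α] [MeasurableSpace β]
    {μ : Measure α} {ν : Measure β} [SFinite ν] {f g : α × β → ℝ}
    (hf : AEMeasurable f (μ.prod ν)) (hg : AEMeasurable g (μ.prod ν))
    (h : ∀ᵐ a ∂μ, ∀ᵐ b ∂ν, f (a, b) = g (a, b)) : f =ᵐ[μ.prod ν] g := by
  -- The passage from sections to the product needs a measurable equality set, hence the measurable
  -- versions.
  have hm : ∀ᵐ z ∂μ.prod ν, hf.mk f z = hg.mk g z := by
    rw [Measure.ae_prod_iff_ae_ae (measurableSet_eq_fun hf.measurable_mk hg.measurable_mk)]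
    filter_upwards [h, Measure.ae_ae_of_ae_prod hf.ae_eq_mk,
      Measure.ae_ae_of_ae_prod hg.ae_eq_mk] with a h0 h1 h2
    filter_upwards [h0, h1, h2] with b h0 h1 h2
    rw [← h1, ← h2, h0]
  filter_upwards [hm, hf.ae_eq_mk, hg.ae_eq_mk] with z h0 h1 h2
  rw [h1, h2, h0]

/-! ### Continuous time-dependent coefficients on the horizon. -/

section HorizonCoefficients

variable {Ω : Type*} [MeasurableSpace Ω] {P : Measure Ω} {t₀ T : ℝ} {c : ℝ → ℝ}

theorem ContinuousOn.aemeasurable_fst_prod [SFinite P] (h₀ : 0 ≤ t₀)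
    (hc : ContinuousOn c (Icc 0 T)) :
    AEMeasurable (fun z : ℝ × Ω => c z.1) ((volume.restrict (Icc t₀ T)).prod P) :=
  ((hc.mono (Icc_subset_Icc_left h₀)).aemeasurable measurableSet_Icc).comp_quasiMeasurePreserving
    Measure.quasiMeasurePreserving_fst

theorem MeasureTheory.Integrable.continuousOn_fst_mul [SFinite P] (h₀ : 0 ≤ t₀)
    (hc : ContinuousOn c (Icc 0 T)) {F : ℝ × Ω → ℝ}
    (hF : Integrable F ((volume.restrict (Icc t₀ T)).prod P)) :
    Integrable (fun z => c z.1 * F z) ((volume.restrict (Icc t₀ T)).prod P) := by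
  obtain ⟨C, hC⟩ := isCompact_Icc.exists_bound_of_continuousOn hc
  refine hF.bdd_mul (c := C) (hc.aemeasurable_fst_prod h₀).aestronglyMeasurable ?_
  have h1 : ∀ᵐ t ∂volume.restrict (Icc t₀ T), ‖c t‖ ≤ C := by
    filter_upwards [ae_restrict_mem measurableSet_Icc] with t ht
    exact hC t (Icc_subset_Icc_left h₀ ht)
  exact Measure.quasiMeasurePreserving_fst.ae h1

end HorizonCoefficients

namespace SwitchingGame

variable {I S : Type*} [Fintype I] [Fintype S]

/-- Lebesgue measure on the remaining time interval `[t₀, T]`. -/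
noncomputable abbrev horizon (G : SwitchingGame I S) (t₀ : ℝ) : Measure ℝ :=
  volume.restrict (Icc t₀ G.T)

theorem intervalIntegral_eq_horizon (G : SwitchingGame I S) {t₀ : ℝ} (h : t₀ ≤ G.T) (f : ℝ → ℝ) :
    ∫ t in t₀..G.T, f t = ∫ t, f t ∂G.horizon t₀ := by
  rw [intervalIntegral.integral_of_le h, horizon, restrict_Ioc_eq_restrict_Icc]

end SwitchingGame

/-! ### Integrability along a play, laws of the regime, and Dynkin's formula. -/

namespace Play

variable {I S : Type*} [Fintype I] [Fintype S] {G : SwitchingGame I S} {t₀ : ℝ} {s₀ : S}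
  {Ω : Type*} [MeasurableSpace Ω] {P : Measure Ω}

/-- The switching rate from the current regime to `y` along a play. -/
def switchRate (p : Play G t₀ s₀ P) (t : ℝ) (x y : S) (ω : Ω) : ℝ :=
  G.rate (fun j x y => p.b₁ j t x y ω) (fun j => p.u j t ω) (fun j => p.ubar j t ω) t x y

theorem measurableSet_regime (p : Play G t₀ s₀ P) (t : ℝ) (x : S) :
    MeasurableSet {ω | p.s t ω = x} :=
  (p.s_meas x).preimage (measurable_prodMk_left (x := t))

theorem regimeInfo_le (p : Play G t₀ s₀ P) (t : ℝ) : regimeInfo t₀ p.s t ≤ ‹MeasurableSpace Ω› := by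
  refine iSup₂_le fun r _ => ?_
  rintro _ ⟨A, -, rfl⟩
  have : p.s r ⁻¹' A = ⋃ x ∈ A, {ω | p.s r ω = x} := by ext; simp
  rw [this]
  exact MeasurableSet.biUnion (to_countable A) fun x _ => p.measurableSet_regime r x

theorem measurableSet_regime_regimeInfo (p : Play G t₀ s₀ P) {t : ℝ} (ht : t₀ ≤ t) (x : S) :
    MeasurableSet[regimeInfo t₀ p.s t] {ω | p.s t ω = x} :=
  le_iSup₂_of_le (f := fun r (_ : r ∈ Icc t₀ t) => MeasurableSpace.comap (p.s r) ⊤) t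
    ⟨ht, le_rfl⟩ le_rfl _ ⟨{x}, trivial, rfl⟩

variable [IsProbabilityMeasure P] (p : Play G t₀ s₀ P)

/-- The random factors are squares or products of `L²` functions, or single `L²` functions on a
finite measure space; the continuous coefficients are bounded. -/
theorem integrable_switchRate_fixed (h₀ : 0 ≤ t₀) (x y : S) :
    Integrable (fun z : ℝ × Ω => p.switchRate z.1 x y z.2) ((G.horizon t₀).prod P) := by
  refine integrable_finsetSum _ fun j _ => ?_
  have hw : MemLp (fun z : ℝ × Ω => p.u j z.1 z.2 - p.ubar j z.1 z.2) 2
    ((G.horizon t₀).prod P) := (p.u_sq j).sub (p.ubar_sq j)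
  have h1 : Integrable (fun _ : ℝ × Ω => (1 : ℝ)) ((G.horizon t₀).prod P) := integrable_const 1
  have e5 := h1.continuousOn_fst_mul h₀ (G.b₀bar_cont j x y)
  simp only [mul_one] at e5
  exact ((((hw.integrable_sq.continuousOn_fst_mul h₀ (G.b₂_cont j x y)).add
    ((p.ubar_sq j).integrable_sq.continuousOn_fst_mul h₀ (G.b₂bar_cont j x y))).add
    ((p.b₁_sq j x y).integrable_mul hw)).add
    (((p.ubar_sq j).integrable one_le_two).continuousOn_fst_mul h₀ (G.b₁bar_cont j x y))).add e5

theorem integrable_switchRate (h₀ : 0 ≤ t₀) (y : S) :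
    Integrable (fun z : ℝ × Ω => p.switchRate z.1 (p.s z.1 z.2) y z.2) ((G.horizon t₀).prod P) :=
  integrable_comp_fibre (σ := fun z : ℝ × Ω => p.s z.1 z.2) p.s_meas
    (F := fun x z => p.switchRate z.1 x y z.2) fun x => p.integrable_switchRate_fixed h₀ x y

theorem integrable_runningCost (h₀ : 0 ≤ t₀) (i : I) :
    Integrable (fun z : ℝ × Ω =>
      G.runningCost i z.1 (p.s z.1 z.2) (p.u i z.1 z.2) (p.ubar i z.1 z.2))
      ((G.horizon t₀).prod P) := by
  refine integrable_comp_fibre (σ := fun z : ℝ × Ω => p.s z.1 z.2) p.s_meas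
    (F := fun x z => G.runningCost i z.1 x (p.u i z.1 z.2) (p.ubar i z.1 z.2)) fun x => ?_
  have hw : MemLp (fun z : ℝ × Ω => p.u i z.1 z.2 - p.ubar i z.1 z.2) 2
    ((G.horizon t₀).prod P) := (p.u_sq i).sub (p.ubar_sq i)
  exact ((hw.integrable_sq.continuousOn_fst_mul h₀ (G.r_cont i x)).add
    ((p.ubar_sq i).integrable_sq.continuousOn_fst_mul h₀ (G.rbar_cont i x))).add
    (((p.ubar_sq i).integrable one_le_two).continuousOn_fst_mul h₀ (G.eps_cont i x))

theorem integrable_comp_regime (t : ℝ) (f : S → ℝ) : Integrable (fun ω => f (p.s t ω)) P :=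
  integrable_comp_fibre (p.measurableSet_regime t) (F := fun x _ => f x)
    fun _ => integrable_const _

theorem integral_comp_regime (t : ℝ) (f : S → ℝ) :
    ∫ ω, f (p.s t ω) ∂P = ∑ x, f x * P.real {ω | p.s t ω = x} := by
  rw [integral_comp_fibre (p.measurableSet_regime t) (F := fun x _ => f x)
    fun _ => integrable_const _]
  simp [mul_comm]

/-- The mean rate of entering `y`. -/
noncomputable def meanRate (t : ℝ) (y : S) : ℝ := ∫ ω, p.switchRate t (p.s t ω) y ω ∂P

theorem integrable_meanRate (h₀ : 0 ≤ t₀) (y : S) :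
    Integrable (fun t => p.meanRate t y) (G.horizon t₀) :=
  (p.integrable_switchRate h₀ y).integral_prod_left

theorem intervalIntegrable_meanRate (h₀ : 0 ≤ t₀) (h₁ : t₀ ≤ G.T) (y : S) :
    IntervalIntegrable (fun t => p.meanRate t y) volume t₀ G.T :=
  (intervalIntegrable_iff_integrableOn_Icc_of_le h₁).2 (p.integrable_meanRate h₀ y)

/-- The forward equation for the law of the regime: the martingale problem for the indicator of `y`,
in expectation, followed by Fubini. -/
theorem prob_regime_eq (h₀ : 0 ≤ t₀) (y : S) {t : ℝ} (ht : t ∈ Icc t₀ G.T) :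
    P.real {ω | p.s t ω = y} = P.real {ω | p.s t₀ ω = y} + ∫ r in t₀..t, p.meanRate r y := by
  classical
  have hprob : ∀ r, ∫ ω, (if p.s r ω = y then (1 : ℝ) else 0) ∂P = P.real {ω | p.s r ω = y} := by
    intro r
    rw [p.integral_comp_regime r fun x => if x = y then (1 : ℝ) else 0]
    simp
  have hle : (volume.restrict (uIoc t₀ t)).prod P ≤ (G.horizon t₀).prod P := by
    refine Measure.prod_mono (Measure.restrict_mono ?_ le_rfl) le_rfl
    rw [uIoc_of_le ht.1]
    exact fun r hr => ⟨hr.1.le, hr.2.trans ht.2⟩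
  have hint := (p.integrable_switchRate h₀ y).mono_measure hle
  have hswap : ∫ ω, (∫ r in t₀..t, p.switchRate r (p.s r ω) y ω) ∂P =
      ∫ r in t₀..t, p.meanRate r y :=
    (intervalIntegral_integral_swap (f := fun r ω => p.switchRate r (p.s r ω) y ω) hint).symm
  have hint' : Integrable (fun ω => ∫ r in t₀..t, p.switchRate r (p.s r ω) y ω) P := by
    simp only [intervalIntegral.integral_of_le ht.1]
    rw [uIoc_of_le ht.1] at hint
    exact hint.integral_prod_right
  have hm := integral_congr_ae (p.martingale (fun x => if x = y then 1 else 0) t₀ t le_rfl ht.1 ht.2)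
  rw [integral_condExp (p.ℱ.le t₀)] at hm
  simp only [ite_mul, one_mul, zero_mul, Finset.sum_ite_eq', Finset.mem_univ, if_true,
    integral_zero] at hm
  change ∫ ω, ((if p.s t ω = y then (1 : ℝ) else 0) - (if p.s t₀ ω = y then (1 : ℝ) else 0)
    - ∫ r in t₀..t, p.switchRate r (p.s r ω) y ω) ∂P = 0 at hm
  have i1 := p.integrable_comp_regime t fun x => if x = y then (1 : ℝ) else 0
  have i0 := p.integrable_comp_regime t₀ fun x => if x = y then (1 : ℝ) else 0
  have hd := (integral_sub (i1.sub i0) hint').symm.trans hm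
  simp only [Pi.sub_apply] at hd
  rw [integral_sub i1 i0, hprob, hprob, hswap] at hd
  linarith

/-- Dynkin's formula for the expectation of a time-dependent function of the regime. -/
theorem integral_terminal_sub_eq (h₀ : 0 ≤ t₀) (h₁ : t₀ ≤ G.T) {v v' : ℝ → S → ℝ}
    (hv : ∀ x, ∀ t ∈ Icc 0 G.T, HasDerivWithinAt (fun t => v t x) (v' t x) (Icc 0 G.T) t)
    (hv' : ∀ x, ContinuousOn (fun t => v' t x) (Icc 0 G.T)) :
    ∫ ω, v G.T (p.s G.T ω) ∂P - v t₀ s₀ =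
      ∫ t, ∫ ω, (v' t (p.s t ω) + ∑ y, v t y * p.switchRate t (p.s t ω) y ω) ∂P
        ∂G.horizon t₀ := by
  have hinit : ∫ ω, v t₀ (p.s t₀ ω) ∂P = v t₀ s₀ := by
    rw [integral_congr_ae (g := fun _ => v t₀ s₀)]
    · simp
    · filter_upwards [p.s_init] with ω h
      rw [h]
  have hsec : ∀ᵐ t ∂G.horizon t₀, ∀ y, Integrable (fun ω => p.switchRate t (p.s t ω) y ω) P :=
    eventually_all.2 fun y => (p.integrable_switchRate h₀ y).prod_right_ae
  have hsub : Icc t₀ G.T ⊆ Icc 0 G.T := Icc_subset_Icc_left h₀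
  -- Since `E v(t, s t) = ∑ x, v t x * P(s t = x)`, it suffices to integrate by parts for each
  -- regime.
  have hparts : ∀ x, v G.T x * P.real {ω | p.s G.T ω = x} - v t₀ x * P.real {ω | p.s t₀ ω = x} =
      ∫ t in t₀..G.T, (v' t x * P.real {ω | p.s t ω = x} + v t x * p.meanRate t x) := fun x =>
    IntervalIntegrable.mul_sub_mul_eq_integral (f := fun t => v t x)
      (g := fun t => P.real {ω | p.s t ω = x})
      (((hv' x).mono hsub).intervalIntegrable_of_Icc h₁) (p.intervalIntegrable_meanRate h₀ h₁ x)
      (by rw [uIcc_of_le h₁]; exact (hv' x).eq_add_integral_of_hasDerivWithinAt h₀ (hv x))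
      (by rw [uIcc_of_le h₁]; exact fun t ht => p.prob_regime_eq h₀ x ht)
  have hprob : ∀ x, ContinuousOn (fun t => P.real {ω | p.s t ω = x}) (uIcc t₀ G.T) := by
    intro x
    have hc := (intervalIntegral.continuousOn_primitive_interval'
      (p.intervalIntegrable_meanRate h₀ h₁ x) left_mem_uIcc).const_add
      (P.real {ω | p.s t₀ ω = x})
    refine hc.congr fun t ht => p.prob_regime_eq h₀ x ?_
    rwa [uIcc_of_le h₁] at ht
  have hvc : ∀ x, ContinuousOn (fun t => v t x) (uIcc t₀ G.T) := by
    intro x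
    rw [uIcc_of_le h₁]
    exact fun t ht => (hv x t (hsub ht)).continuousWithinAt.mono hsub
  rw [← hinit, p.integral_comp_regime G.T (v G.T), p.integral_comp_regime t₀ (v t₀),
    ← Finset.sum_sub_distrib, Finset.sum_congr rfl fun x _ => hparts x,
    ← intervalIntegral.integral_finsetSum, G.intervalIntegral_eq_horizon h₁]
  · refine integral_congr_ae ?_
    filter_upwards [hsec] with t ht
    rw [integral_add (p.integrable_comp_regime t (v' t))
      (integrable_finsetSum _ fun y _ => (ht y).const_mul _), p.integral_comp_regime,
      integral_finsetSum _ fun y _ => (ht y).const_mul _, ← Finset.sum_add_distrib]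
    simp only [integral_const_mul, meanRate]
  · intro x _
    refine IntervalIntegrable.add ?_ ?_
    · refine ContinuousOn.intervalIntegrable (ContinuousOn.mul ?_ (hprob x))
      rw [uIcc_of_le h₁]
      exact (hv' x).mono hsub
    · exact (p.intervalIntegrable_meanRate h₀ h₁ x).continuousOn_mul (hvc x)

end Play

/-! ### Conditional moments of the random coefficients and conditional means of the controls. -/

namespace Play

variable {I S : Type*} [Fintype I] [Fintype S] {G : SwitchingGame I S} {t₀ : ℝ} {s₀ : S}
  {Ω : Type*} [MeasurableSpace Ω] {P : Measure Ω} [IsProbabilityMeasure P] (p : Play G t₀ s₀ P)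

omit [Fintype I] [Fintype S] in
theorem memLp_two_section {ν : Measure ℝ} [SFinite ν] {f : ℝ × Ω → ℝ} (hm : Measurable f)
    (hf : MemLp f 2 (ν.prod P)) : ∀ᵐ t ∂ν, MemLp (fun ω => f (t, ω)) 2 P := by
  filter_upwards [hf.integrable_sq.prod_right_ae] with t ht
  exact (memLp_two_iff_integrable_sq
    (hm.comp measurable_prodMk_left).aestronglyMeasurable).2 ht

/-- `∑_{s'} V_k(t,s') b_{1js(t)s'}(t)`. -/
def weighted (V : I → ℝ → S → ℝ) (j k : I) (t : ℝ) (ω : Ω) : ℝ :=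
  ∑ y, V k t y * p.b₁ j t (p.s t ω) y ω

/-- Given the regime, the products of the random coefficients have the prescribed means. -/
theorem integral_weighted_mul_sub_mom (V : I → ℝ → S → ℝ) :
    ∀ᵐ t ∂G.horizon t₀, ∀ (j k l : I) (c : S → ℝ),
      Integrable (fun ω => c (p.s t ω) * (p.weighted V j k t ω * p.weighted V j l t ω
        - G.mom V j k l t (p.s t ω))) P ∧
      ∫ ω, c (p.s t ω) * (p.weighted V j k t ω * p.weighted V j l t ω
        - G.mom V j k l t (p.s t ω)) ∂P = 0 := by
  have hL2 : ∀ᵐ t ∂G.horizon t₀, ∀ j x y, MemLp (p.b₁ j t x y) 2 P :=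
    eventually_all.2 fun j => eventually_all.2 fun x => eventually_all.2 fun y =>
      memLp_two_section (p.b₁_meas j x y) (p.b₁_sq j x y)
  have hcov : ∀ᵐ t ∂G.horizon t₀, ∀ j x y z,
      P[(fun ω => p.b₁ j t x y ω * p.b₁ j t x z ω) | regimeInfo t₀ p.s t]
        =ᵐ[P] fun _ => G.cov j t x y z :=
    eventually_all.2 fun j => eventually_all.2 fun x => eventually_all.2 fun y =>
      eventually_all.2 fun z => p.b₁_cov j x y z
  -- The exceptional set of times must not depend on `c`, which is later built from the values at
  -- time `t`.
  filter_upwards [hL2, hcov, ae_restrict_mem measurableSet_Icc] with t hb hc ht j k l c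
  have hmul : ∀ x y z, Integrable (fun ω => p.b₁ j t x y ω * p.b₁ j t x z ω) P :=
    fun x y z => (hb j x y).integrable_mul (hb j x z)
  let F : S → Ω → ℝ := fun x ω => ∑ y, ∑ z, c x * (V k t y * V l t z) *
    (p.b₁ j t x y ω * p.b₁ j t x z ω - G.cov j t x y z)
  have hsub : ∀ x y z, Integrable (fun ω => p.b₁ j t x y ω * p.b₁ j t x z ω - G.cov j t x y z) P :=
    fun x y z => (hmul x y z).sub (integrable_const _)
  have hF : ∀ x, Integrable (F x) P := fun x =>
    integrable_finsetSum _ fun y _ => integrable_finsetSum _ fun z _ => (hsub x y z).const_mul _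
  have heq : (fun ω => c (p.s t ω) * (p.weighted V j k t ω * p.weighted V j l t ω
      - G.mom V j k l t (p.s t ω))) = fun ω => F (p.s t ω) ω := by
    funext ω
    simp only [F, weighted, SwitchingGame.mom]
    rw [Finset.sum_mul_sum]
    simp only [← Finset.sum_sub_distrib, Finset.mul_sum]
    refine Finset.sum_congr rfl fun y _ => Finset.sum_congr rfl fun z _ => ?_
    ring
  rw [heq]
  refine ⟨integrable_comp_fibre (p.measurableSet_regime t) hF, ?_⟩
  rw [integral_comp_fibre (p.measurableSet_regime t) hF]
  refine Finset.sum_eq_zero fun x _ => ?_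
  rw [integral_finsetSum _ fun y _ => integrable_finsetSum _ fun z _ =>
    ((hsub x y z).const_mul _).integrableOn]
  refine Finset.sum_eq_zero fun y _ => ?_
  rw [integral_finsetSum _ fun z _ => ((hsub x y z).const_mul _).integrableOn]
  refine Finset.sum_eq_zero fun z _ => ?_
  -- The event `s t = x` belongs to the regime information, so the product may be replaced by its
  -- conditional expectation on it.
  rw [integral_const_mul, integral_sub (hmul x y z).integrableOn (integrable_const _).integrableOn,
    ← setIntegral_condExp (p.regimeInfo_le t) (hmul x y z)
      (p.measurableSet_regime_regimeInfo ht.1 x),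
    integral_congr_ae (ae_restrict_of_ae (hc j x y z)), sub_self, mul_zero]

/-- A decision-maker who plays the profile acts on average by the regime alone. -/
theorem ubar_eq_of_follows {V : I → ℝ → S → ℝ} {j : I} (hc : p.Centred j)
    (hf : p.Follows (G.equilibriumProfile V) j) :
    ∀ᵐ t ∂G.horizon t₀, ∀ᵐ ω ∂P,
      p.ubar j t ω = -(1 / 2 * (G.numBar V j t (p.s t ω) / G.denBar V j t (p.s t ω))) ∧
      p.u j t ω - p.ubar j t ω = -(1 / 2 * (p.weighted V j j t ω / G.den V j t (p.s t ω))) := by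
  have hb : ∀ᵐ t ∂G.horizon t₀, ∀ x y, MemLp (p.b₁ j t x y) 2 P :=
    eventually_all.2 fun x => eventually_all.2 fun y =>
      memLp_two_section (p.b₁_meas j x y) (p.b₁_sq j x y)
  have hmean : ∀ᵐ t ∂G.horizon t₀, ∀ x y,
      P[p.b₁ j t x y | regimeInfo t₀ p.s t] =ᵐ[P] fun _ => 0 :=
    eventually_all.2 fun x => eventually_all.2 fun y => hc x y
  filter_upwards [hb, hmean, p.ubar_eq j, memLp_two_section (p.u_meas j) (p.u_sq j),
    Measure.ae_ae_of_ae_prod hf, ae_restrict_mem measurableSet_Icc] with t hb hmean hubar hu hf ht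
  have hu1 : Integrable (p.u j t) P := hu.integrable one_le_two
  let κ : S → ℝ := fun x => -(1 / 2 * (G.numBar V j t x / G.denBar V j t x))
  -- The feedback with the regime frozen at `x`: a linear combination of centred coefficients plus
  -- the constant `κ x`, so its conditional mean is `κ x`.
  let g : S → Ω → ℝ := fun x =>
    (∑ y, (-(1 / 2) / G.den V j t x * V j t y) • p.b₁ j t x y) + fun _ => κ x
  have hbi : ∀ x y, Integrable ((-(1 / 2) / G.den V j t x * V j t y) • p.b₁ j t x y) P :=
    fun x y => ((hb x y).integrable one_le_two).smul _
  have hgs : ∀ x, Integrable (∑ y, (-(1 / 2) / G.den V j t x * V j t y) • p.b₁ j t x y) P :=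
    fun x => integrable_finsetSum' _ fun y _ => hbi x y
  have hgi : ∀ x, Integrable (g x) P := fun x => (hgs x).add (integrable_const _)
  have hg : ∀ x, P[g x | regimeInfo t₀ p.s t] =ᵐ[P] fun _ => κ x := by
    intro x
    have h1 := condExp_add (hgs x) (integrable_const (κ x)) (regimeInfo t₀ p.s t)
    have h2 := condExp_finsetSum (s := Finset.univ) (fun y _ => hbi x y) (regimeInfo t₀ p.s t)
    have h3 : ∀ᵐ ω ∂P, ∀ y,
        P[(-(1 / 2) / G.den V j t x * V j t y) • p.b₁ j t x y | regimeInfo t₀ p.s t] ω = 0 := by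
      refine eventually_all.2 fun y => ?_
      filter_upwards [condExp_smul (-(1 / 2) / G.den V j t x * V j t y) (p.b₁ j t x y)
        (regimeInfo t₀ p.s t) (μ := P), hmean x y] with ω e1 e2
      rw [e1, Pi.smul_apply, e2, smul_zero]
    filter_upwards [h1, h2, h3] with ω e1 e2 e3
    rw [e1, Pi.add_apply, e2, Finset.sum_apply, Finset.sum_eq_zero fun y _ => e3 y, zero_add,
      condExp_const (p.regimeInfo_le t)]
  have hug : ∀ᵐ ω ∂P, p.u j t ω = g (p.s t ω) ω := by
    filter_upwards [hf] with ω h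
    rw [h]
    simp only [g, κ, SwitchingGame.equilibriumProfile, Pi.add_apply, Finset.sum_apply,
      Pi.smul_apply, smul_eq_mul, mul_assoc, ← Finset.mul_sum]
    ring
  -- Unfreezing the regime: `u j t` and `g x` agree on the event `s t = x`, whose indicator commutes
  -- with the conditional expectation.
  have hcond : ∀ᵐ ω ∂P, ∀ x, p.s t ω = x → P[p.u j t | regimeInfo t₀ p.s t] ω = κ x := by
    refine eventually_all.2 fun x => ?_
    have hA := p.measurableSet_regime_regimeInfo ht.1 x
    have hind : {ω | p.s t ω = x}.indicator (p.u j t) =ᵐ[P] {ω | p.s t ω = x}.indicator (g x) := by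
      filter_upwards [hug] with ω h
      by_cases hx : p.s t ω = x
      · rw [indicator_of_mem (by exact hx), indicator_of_mem (by exact hx), h, hx]
      · rw [indicator_of_notMem (by exact hx), indicator_of_notMem (by exact hx)]
    filter_upwards [condExp_indicator hu1 hA, condExp_indicator (hgi x) hA,
      condExp_congr_ae (m := regimeInfo t₀ p.s t) hind, hg x] with ω e1 e2 e3 e4 hx
    rw [e1, e2, indicator_of_mem (by exact hx), indicator_of_mem (by exact hx), e4] at e3
    exact e3
  filter_upwards [hcond, hubar, hug] with ω h1 h2 h3
  have h4 : p.ubar j t ω = κ (p.s t ω) := h2.trans (h1 _ rfl)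
  refine ⟨h4, ?_⟩
  rw [h4, h3]
  simp only [g, weighted, Pi.add_apply, Finset.sum_apply, Pi.smul_apply, smul_eq_mul, mul_assoc,
    ← Finset.mul_sum]
  ring

end Play

/-! ### Completion of squares and continuity of the coefficients of the system. -/

namespace SwitchingGame

variable {I S : Type*} [Fintype I] [Fintype S]

theorem sum_value_mul_rate (G : SwitchingGame I S) (v : S → ℝ) (β : I → S → S → ℝ)
    (u ubar : I → ℝ) (t : ℝ) (x : S) :
    ∑ y, v y * G.rate β u ubar t x y = ∑ j, ((∑ y, v y * G.b₂ j t x y) * (u j - ubar j) ^ 2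
      + (∑ y, v y * G.b₂bar j t x y) * ubar j ^ 2 + (∑ y, v y * β j x y) * (u j - ubar j)
      + (∑ y, v y * G.b₁bar j t x y) * ubar j + ∑ y, v y * G.b₀bar j t x y) := by
  simp only [rate, Finset.mul_sum]
  rw [Finset.sum_comm]
  refine Finset.sum_congr rfl fun j _ => ?_
  simp only [Finset.sum_mul, ← Finset.sum_add_distrib]
  refine Finset.sum_congr rfl fun y _ => ?_
  ring

/-- When the others use the equilibrium feedback, completing the squares turns the Hamiltonian into
the loss of `i` plus a combination of centred products of the random coefficients. -/
theorem hamiltonian_sub_odeTerm [DecidableEq I] (G : SwitchingGame I S) (V : I → ℝ → S → ℝ) (i : I)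
    {t : ℝ} {x : S} (β : I → S → S → ℝ) (u ubar : I → ℝ) {B : I → I → ℝ}
    (hB : ∀ j k, B j k = ∑ y, V k t y * β j x y)
    (hD : 0 < G.den V i t x) (hDbar : 0 < G.denBar V i t x)
    (hu : ∀ j, j ≠ i → ubar j = -(1 / 2 * (G.numBar V j t x / G.denBar V j t x)) ∧
      u j - ubar j = -(1 / 2 * (B j j / G.den V j t x))) :
    ∑ y, V i t y * G.rate β u ubar t x y + G.runningCost i t x (u i) (ubar i) - G.odeTerm V i t x =
      (G.den V i t x * (u i - ubar i + 1 / 2 * (B i i / G.den V i t x)) ^ 2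
        + G.denBar V i t x * (ubar i + 1 / 2 * (G.numBar V i t x / G.denBar V i t x)) ^ 2)
      + (-(1 / 4 / G.den V i t x) * (B i i * B i i - G.mom V i i i t x)
        + ∑ j ∈ Finset.univ.erase i,
          (1 / 4 * (∑ y, V i t y * G.b₂ j t x y) / G.den V j t x ^ 2
              * (B j j * B j j - G.mom V j j j t x)
            + -(1 / 2 / G.den V j t x) * (B j i * B j j - G.mom V j i j t x))) := by
  have hswap : ∑ y, V i t y * ∑ j, G.b₀bar j t x y = ∑ j, ∑ y, V i t y * G.b₀bar j t x y := by
    simp only [Finset.mul_sum]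
    exact Finset.sum_comm
  rw [G.sum_value_mul_rate (V i t), odeTerm, hswap]
  simp only [← hB]
  rw [← Finset.add_sum_erase _ _ (Finset.mem_univ i),
    ← Finset.add_sum_erase (Finset.univ : Finset I) (fun j => ∑ y, V i t y * G.b₀bar j t x y)
      (Finset.mem_univ i)]
  -- For `j ≠ i` the feedback is substituted and each product of `B`'s is split into its moment and
  -- a centred rest. The denominators of `j` occur only as inverses and are never cancelled.
  have hothers : ∑ j ∈ Finset.univ.erase i, ((∑ y, V i t y * G.b₂ j t x y) * (u j - ubar j) ^ 2
        + (∑ y, V i t y * G.b₂bar j t x y) * ubar j ^ 2 + B j i * (u j - ubar j)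
        + (∑ y, V i t y * G.b₁bar j t x y) * ubar j + ∑ y, V i t y * G.b₀bar j t x y) =
      ∑ j ∈ Finset.univ.erase i, ∑ y, V i t y * G.b₀bar j t x y
      + 1 / 4 * ∑ j ∈ Finset.univ.erase i,
        (∑ y, V i t y * G.b₂ j t x y) * (G.mom V j j j t x / G.den V j t x ^ 2)
      + 1 / 4 * ∑ j ∈ Finset.univ.erase i,
        (∑ y, V i t y * G.b₂bar j t x y) * (G.numBar V j t x / G.denBar V j t x) ^ 2
      - 1 / 2 * ∑ j ∈ Finset.univ.erase i, G.mom V j i j t x / G.den V j t x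
      - 1 / 2 * ∑ j ∈ Finset.univ.erase i,
        (∑ y, V i t y * G.b₁bar j t x y) * (G.numBar V j t x / G.denBar V j t x)
      + ∑ j ∈ Finset.univ.erase i,
          (1 / 4 * (∑ y, V i t y * G.b₂ j t x y) / G.den V j t x ^ 2
              * (B j j * B j j - G.mom V j j j t x)
            + -(1 / 2 / G.den V j t x) * (B j i * B j j - G.mom V j i j t x)) := by
    rw [Finset.mul_sum, Finset.mul_sum, Finset.mul_sum, Finset.mul_sum, ← Finset.sum_add_distrib,
      ← Finset.sum_add_distrib, ← Finset.sum_sub_distrib, ← Finset.sum_sub_distrib,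
      ← Finset.sum_add_distrib]
    refine Finset.sum_congr rfl fun j hj => ?_
    obtain ⟨h1, h2⟩ := hu j (Finset.ne_of_mem_erase hj)
    rw [h2, h1]
    ring
  rw [hothers]
  have hsquare : ∀ D w b : ℝ, 0 < D →
      D * (w + 1 / 2 * (b / D)) ^ 2 = D * w ^ 2 + b * w + 1 / 4 * (b ^ 2 / D) := by
    intro D w b h
    field_simp
    ring
  rw [hsquare _ _ _ hD, hsquare _ _ _ hDbar]
  simp only [runningCost, den, denBar, numBar]
  ring

theorem continuousOn_value [DecidableEq I] {G : SwitchingGame I S} {V : I → ℝ → S → ℝ}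
    (hV : G.SolvesSystem V) (i : I) (x : S) : ContinuousOn (fun t => V i t x) (Icc 0 G.T) :=
  fun t ht => (hV.1 i t ht x).choose_spec.1.continuousWithinAt

theorem continuousOn_den {G : SwitchingGame I S} {V : I → ℝ → S → ℝ}
    (hV : ∀ i x, ContinuousOn (fun t => V i t x) (Icc 0 G.T)) (i : I) (x : S) :
    ContinuousOn (fun t => G.den V i t x) (Icc 0 G.T) :=
  (G.r_cont i x).add (continuousOn_finsetSum _ fun y _ => (hV i y).mul (G.b₂_cont i x y))

theorem continuousOn_denBar {G : SwitchingGame I S} {V : I → ℝ → S → ℝ}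
    (hV : ∀ i x, ContinuousOn (fun t => V i t x) (Icc 0 G.T)) (i : I) (x : S) :
    ContinuousOn (fun t => G.denBar V i t x) (Icc 0 G.T) :=
  (G.rbar_cont i x).add (continuousOn_finsetSum _ fun y _ => (hV i y).mul (G.b₂bar_cont i x y))

theorem continuousOn_numBar {G : SwitchingGame I S} {V : I → ℝ → S → ℝ}
    (hV : ∀ i x, ContinuousOn (fun t => V i t x) (Icc 0 G.T)) (i : I) (x : S) :
    ContinuousOn (fun t => G.numBar V i t x) (Icc 0 G.T) :=
  (G.eps_cont i x).add (continuousOn_finsetSum _ fun y _ => (hV i y).mul (G.b₁bar_cont i x y))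

theorem continuousOn_mom {G : SwitchingGame I S} {V : I → ℝ → S → ℝ}
    (hV : ∀ i x, ContinuousOn (fun t => V i t x) (Icc 0 G.T)) (j i k : I) (x : S) :
    ContinuousOn (fun t => G.mom V j i k t x) (Icc 0 G.T) :=
  continuousOn_finsetSum _ fun y _ => continuousOn_finsetSum _ fun z _ =>
    ((hV i y).mul (hV k z)).mul (G.cov_cont j x y z)

/-- By the system this makes `V` continuously differentiable in time, as Dynkin's formula requires.
-/
theorem continuousOn_odeTerm [DecidableEq I] {G : SwitchingGame I S} {V : I → ℝ → S → ℝ}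
    (hV : ∀ i x, ContinuousOn (fun t => V i t x) (Icc 0 G.T))
    (hden : ∀ i, ∀ t ∈ Icc 0 G.T, ∀ x, 0 < G.den V i t x)
    (hdenBar : ∀ i, ∀ t ∈ Icc 0 G.T, ∀ x, 0 < G.denBar V i t x) (i : I) (x : S) :
    ContinuousOn (fun t => G.odeTerm V i t x) (Icc 0 G.T) := by
  have hD : ∀ j, ∀ t ∈ Icc 0 G.T, G.den V j t x ≠ 0 := fun j t ht => (hden j t ht x).ne'
  have hDbar : ∀ j, ∀ t ∈ Icc 0 G.T, G.denBar V j t x ≠ 0 := fun j t ht => (hdenBar j t ht x).ne'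
  have cD := fun j => continuousOn_den hV j x
  have cDbar := fun j => continuousOn_denBar hV j x
  have cN := fun j => continuousOn_numBar hV j x
  have cM := fun j k l => continuousOn_mom hV j k l x
  have cV : ∀ {b : ℝ → S → ℝ}, (∀ y, ContinuousOn (fun t => b t y) (Icc 0 G.T)) →
      ContinuousOn (fun t => ∑ y, V i t y * b t y) (Icc 0 G.T) := fun hb =>
    continuousOn_finsetSum _ fun y _ => (hV i y).mul (hb y)
  unfold odeTerm
  refine ((((((cV fun y => ?_).sub ?_).sub ?_).add ?_).add ?_).sub ?_).sub ?_
  · exact continuousOn_finsetSum _ fun j _ => G.b₀bar_cont j x y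
  · exact ((cM i i i).div (cD i) (hD i)).const_mul _
  · exact (((cN i).pow 2).div (cDbar i) (hDbar i)).const_mul _
  · exact (continuousOn_finsetSum _ fun j _ => (cV (G.b₂_cont j x)).mul
      ((cM j j j).div ((cD j).pow 2) fun t ht => pow_ne_zero 2 (hD j t ht))).const_mul _
  · exact (continuousOn_finsetSum _ fun j _ => (cV (G.b₂bar_cont j x)).mul
      (((cN j).div (cDbar j) (hDbar j)).pow 2)).const_mul _
  · exact (continuousOn_finsetSum _ fun j _ => (cM j i j).div (cD j) (hD j)).const_mul _
  · exact (continuousOn_finsetSum _ fun j _ => (cV (G.b₁bar_cont j x)).mul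
      ((cN j).div (cDbar j) (hDbar j))).const_mul _

end SwitchingGame

/-! ### The penalty and its relation to the cost. -/

namespace Play

variable {I S : Type*} [Fintype I] [Fintype S] {G : SwitchingGame I S} {t₀ : ℝ} {s₀ : S}
  {Ω : Type*} [MeasurableSpace Ω] {P : Measure Ω} (p : Play G t₀ s₀ P)

/-- The drift of `V i t (s t)` along the play plus the running cost of `i`. -/
noncomputable def hamiltonian [DecidableEq I] (V : I → ℝ → S → ℝ) (i : I) (t : ℝ) (ω : Ω) : ℝ :=
  ∑ y, V i t y * p.switchRate t (p.s t ω) y ω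
    + G.runningCost i t (p.s t ω) (p.u i t ω) (p.ubar i t ω) - G.odeTerm V i t (p.s t ω)

/-- The rate at which `i` loses by not using the equilibrium feedback. -/
noncomputable def penalty (V : I → ℝ → S → ℝ) (i : I) (t : ℝ) (ω : Ω) : ℝ :=
  G.den V i t (p.s t ω) *
      (p.u i t ω - p.ubar i t ω + 1 / 2 * (p.weighted V i i t ω / G.den V i t (p.s t ω))) ^ 2
    + G.denBar V i t (p.s t ω) *
      (p.ubar i t ω + 1 / 2 * (G.numBar V i t (p.s t ω) / G.denBar V i t (p.s t ω))) ^ 2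

section Values

variable {V : I → ℝ → S → ℝ}
  (hden : ∀ i, ∀ t ∈ Icc 0 G.T, ∀ x, 0 < G.den V i t x)
  (hdenBar : ∀ i, ∀ t ∈ Icc 0 G.T, ∀ x, 0 < G.denBar V i t x)

include hden hdenBar

theorem penalty_nonneg (i : I) {t : ℝ} (ht : t ∈ Icc 0 G.T) (ω : Ω) : 0 ≤ p.penalty V i t ω :=
  add_nonneg (mul_nonneg (hden i t ht _).le (sq_nonneg _))
    (mul_nonneg (hdenBar i t ht _).le (sq_nonneg _))

/-- Both weights are positive, so both squares vanish; adding the two linear equations eliminates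
`ū_i`. -/
theorem eq_profile_of_penalty_eq_zero (i : I) {t : ℝ} (ht : t ∈ Icc 0 G.T) {ω : Ω}
    (h : p.penalty V i t ω = 0) :
    p.u i t ω = G.equilibriumProfile V i t (p.s t ω) (fun x y => p.b₁ i t x y ω) := by
  have h1 := hden i t ht (p.s t ω)
  have h2 := hdenBar i t ht (p.s t ω)
  obtain ⟨e1, e2⟩ := (add_eq_zero_iff_of_nonneg (mul_nonneg h1.le (sq_nonneg _))
    (mul_nonneg h2.le (sq_nonneg _))).1 h
  have f1 := pow_eq_zero_iff two_ne_zero |>.1 ((mul_eq_zero.1 e1).resolve_left h1.ne')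
  have f2 := pow_eq_zero_iff two_ne_zero |>.1 ((mul_eq_zero.1 e2).resolve_left h2.ne')
  rw [weighted] at f1
  rw [SwitchingGame.equilibriumProfile]
  linarith

variable [IsProbabilityMeasure P]

omit hden hdenBar in
theorem penalty_ae_eq_zero {i : I} (hc : p.Centred i)
    (hf : p.Follows (G.equilibriumProfile V) i) :
    ∀ᵐ t ∂G.horizon t₀, p.penalty V i t =ᵐ[P] 0 := by
  filter_upwards [p.ubar_eq_of_follows hc hf] with t ht
  filter_upwards [ht] with ω ⟨h1, h2⟩
  rw [penalty, h2, h1]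
  simp

omit hden hdenBar in
theorem aemeasurable_profile (hV : ∀ i x, ContinuousOn (fun t => V i t x) (Icc 0 G.T))
    (h₀ : 0 ≤ t₀) (i : I) :
    AEMeasurable (fun z : ℝ × Ω =>
      G.equilibriumProfile V i z.1 (p.s z.1 z.2) (fun x y => p.b₁ i z.1 x y z.2))
      ((G.horizon t₀).prod P) := by
  refine aemeasurable_comp_fibre (σ := fun z : ℝ × Ω => p.s z.1 z.2) p.s_meas
    (F := fun x z => G.equilibriumProfile V i z.1 x (fun x y => p.b₁ i z.1 x y z.2)) fun x => ?_
  have hD := (SwitchingGame.continuousOn_den hV i x).aemeasurable_fst_prod h₀ (P := P)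
  have hDbar := (SwitchingGame.continuousOn_denBar hV i x).aemeasurable_fst_prod h₀ (P := P)
  have hN := (SwitchingGame.continuousOn_numBar hV i x).aemeasurable_fst_prod h₀ (P := P)
  have hsum : AEMeasurable (fun z : ℝ × Ω => ∑ y, V i z.1 y * p.b₁ i z.1 x y z.2)
      ((G.horizon t₀).prod P) := Finset.aemeasurable_fun_sum _ fun y _ =>
    ((hV i y).aemeasurable_fst_prod h₀).mul (p.b₁_meas i x y).aemeasurable
  exact ((hsum.div hD).const_mul _).neg.sub ((hN.div hDbar).const_mul _)

variable [DecidableEq I]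

theorem integrable_hamiltonian (hV : ∀ i x, ContinuousOn (fun t => V i t x) (Icc 0 G.T))
    (h₀ : 0 ≤ t₀) (i : I) :
    Integrable (fun z : ℝ × Ω => p.hamiltonian V i z.1 z.2) ((G.horizon t₀).prod P) := by
  refine ((integrable_finsetSum _ fun y _ =>
    (p.integrable_switchRate h₀ y).continuousOn_fst_mul h₀ (hV i y)).add
    (p.integrable_runningCost h₀ i)).sub ?_
  refine integrable_comp_fibre (σ := fun z : ℝ × Ω => p.s z.1 z.2) p.s_meas
    (F := fun x z => G.odeTerm V i z.1 x) fun x => ?_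
  have h1 : Integrable (fun _ : ℝ × Ω => (1 : ℝ)) ((G.horizon t₀).prod P) := integrable_const 1
  simpa only [mul_one] using h1.continuousOn_fst_mul h₀
    (SwitchingGame.continuousOn_odeTerm hV hden hdenBar i x)

/-- Dynkin's formula for `V i`, whose time derivative is `-odeTerm`, plus Fubini for the running
cost. No one's strategy enters. -/
theorem cost_sub_value_eq (hV : G.SolvesSystem V) (h₀ : 0 ≤ t₀) (h₁ : t₀ ≤ G.T) (i : I) :
    p.cost i - V i t₀ s₀ = ∫ t, ∫ ω, p.hamiltonian V i t ω ∂P ∂G.horizon t₀ := by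
  have hVc := SwitchingGame.continuousOn_value hV
  have hode := SwitchingGame.continuousOn_odeTerm hVc hden hdenBar i
  have hdynkin := p.integral_terminal_sub_eq h₀ h₁ (v := V i) (v' := fun t x => -G.odeTerm V i t x)
    (fun x t ht => by
      obtain ⟨V', hV', h⟩ := hV.1 i t ht x
      rwa [eq_neg_of_add_eq_zero_left h] at hV') fun x => (hode x).neg
  have hrun := p.integrable_runningCost h₀ i
  have hcost : p.cost i = ∫ ω, V i G.T (p.s G.T ω) ∂P + ∫ t, ∫ ω,
      G.runningCost i t (p.s t ω) (p.u i t ω) (p.ubar i t ω) ∂P ∂G.horizon t₀ := by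
    rw [cost, integral_integral_swap hrun]
    simp only [G.intervalIntegral_eq_horizon h₁, ← hV.2]
    exact integral_add (p.integrable_comp_regime G.T (V i G.T)) hrun.integral_prod_right
  have hham := p.integrable_hamiltonian hden hdenBar hVc h₀ i
  have hdrift : ∀ z : ℝ × Ω, -G.odeTerm V i z.1 (p.s z.1 z.2)
      + ∑ y, V i z.1 y * p.switchRate z.1 (p.s z.1 z.2) y z.2 = p.hamiltonian V i z.1 z.2
      - G.runningCost i z.1 (p.s z.1 z.2) (p.u i z.1 z.2) (p.ubar i z.1 z.2) := by
    intro z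
    rw [hamiltonian]
    ring
  have hsplit : ∫ t, ∫ ω, (-G.odeTerm V i t (p.s t ω)
      + ∑ y, V i t y * p.switchRate t (p.s t ω) y ω) ∂P ∂G.horizon t₀ =
      ∫ t, ∫ ω, p.hamiltonian V i t ω ∂P ∂G.horizon t₀ - ∫ t, ∫ ω,
        G.runningCost i t (p.s t ω) (p.u i t ω) (p.ubar i t ω) ∂P ∂G.horizon t₀ := by
    rw [← integral_sub hham.integral_prod_left hrun.integral_prod_left]
    refine integral_congr_ae ?_
    filter_upwards [hham.prod_right_ae, hrun.prod_right_ae] with t e1 e2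
    rw [← integral_sub e1 e2]
    exact integral_congr_ae (Eventually.of_forall fun ω => hdrift (t, ω))
  rw [hsplit] at hdynkin
  linarith

/-- Against the equilibrium strategies of the others, the Hamiltonian is the penalty in mean. -/
theorem integral_hamiltonian_eq (hV : ∀ i x, ContinuousOn (fun t => V i t x) (Icc 0 G.T))
    (h₀ : 0 ≤ t₀) {i : I} (hdev : p.IsDeviationFrom (G.equilibriumProfile V) i) :
    ∀ᵐ t ∂G.horizon t₀, Integrable (p.penalty V i t) P ∧
      ∫ ω, p.hamiltonian V i t ω ∂P = ∫ ω, p.penalty V i t ω ∂P := by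
  have hothers : ∀ᵐ t ∂G.horizon t₀, ∀ j, j ≠ i → ∀ᵐ ω ∂P,
      p.ubar j t ω = -(1 / 2 * (G.numBar V j t (p.s t ω) / G.denBar V j t (p.s t ω))) ∧
      p.u j t ω - p.ubar j t ω = -(1 / 2 * (p.weighted V j j t ω / G.den V j t (p.s t ω))) :=
    eventually_all.2 fun j => by
      by_cases hj : j = i
      · exact Eventually.of_forall fun t h => absurd hj h
      · filter_upwards [p.ubar_eq_of_follows (hdev j hj).1 (hdev j hj).2] with t ht _ using ht
  filter_upwards [hothers, p.integral_weighted_mul_sub_mom V,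
    (p.integrable_hamiltonian hden hdenBar hV h₀ i).prod_right_ae,
    ae_restrict_mem measurableSet_Icc] with t hoth hmom hint ht
  have ht' : t ∈ Icc 0 G.T := Icc_subset_Icc_left h₀ ht
  let X : I → I → I → (S → ℝ) → Ω → ℝ := fun j k l c ω => c (p.s t ω) *
    (p.weighted V j k t ω * p.weighted V j l t ω - G.mom V j k l t (p.s t ω))
  let c : I → S → ℝ := fun j x => 1 / 4 * (∑ y, V i t y * G.b₂ j t x y) / G.den V j t x ^ 2
  let d : I → S → ℝ := fun j x => -(1 / 2 / G.den V j t x)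
  let e : S → ℝ := fun x => -(1 / 4 / G.den V i t x)
  -- The centred remainder of `hamiltonian_sub_odeTerm`.
  let Z : Ω → ℝ := fun ω => X i i i e ω
    + ∑ j ∈ Finset.univ.erase i, (X j j j (c j) ω + X j i j (d j) ω)
  have hX : ∀ j k l c, Integrable (X j k l c) P := fun j k l c => (hmom j k l c).1
  have hX0 : ∀ j k l c, ∫ ω, X j k l c ω ∂P = 0 := fun j k l c => (hmom j k l c).2
  have hsum : ∀ j ∈ Finset.univ.erase i, Integrable (fun ω => X j j j (c j) ω + X j i j (d j) ω) P :=
    fun j _ => (hX j j j (c j)).add (hX j i j (d j))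
  have hZ : Integrable Z P := (hX i i i e).add (integrable_finsetSum _ hsum)
  have hZ0 : ∫ ω, Z ω ∂P = 0 := by
    simp only [Z]
    rw [integral_add (hX i i i e) (integrable_finsetSum _ hsum), integral_finsetSum _ hsum, hX0,
      zero_add]
    refine Finset.sum_eq_zero fun j _ => ?_
    rw [integral_add (hX j j j (c j)) (hX j i j (d j)), hX0, hX0, add_zero]
  have heq : ∀ᵐ ω ∂P, p.hamiltonian V i t ω - Z ω = p.penalty V i t ω := by
    have hoth' : ∀ᵐ ω ∂P, ∀ j, j ≠ i →
        p.ubar j t ω = -(1 / 2 * (G.numBar V j t (p.s t ω) / G.denBar V j t (p.s t ω))) ∧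
        p.u j t ω - p.ubar j t ω = -(1 / 2 * (p.weighted V j j t ω / G.den V j t (p.s t ω))) :=
      eventually_all.2 fun j => by
        by_cases hj : j = i
        · exact Eventually.of_forall fun ω h => absurd hj h
        · filter_upwards [hoth j hj] with ω h _ using h
    filter_upwards [hoth'] with ω h
    exact sub_eq_of_eq_add (G.hamiltonian_sub_odeTerm V i (fun j x y => p.b₁ j t x y ω)
      (fun j => p.u j t ω) (fun j => p.ubar j t ω) (B := fun j k => p.weighted V j k t ω)
      (fun _ _ => rfl) (hden i t ht' _) (hdenBar i t ht' _) h)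
  -- Integrability of the penalty comes from this identity rather than from bounds on its squares.
  refine ⟨(hint.sub hZ).congr heq, ?_⟩
  rw [← integral_congr_ae heq, integral_sub hint hZ, hZ0, sub_zero]

theorem cost_sub_value_eq_integral_penalty (hV : G.SolvesSystem V) (h₀ : 0 ≤ t₀) (h₁ : t₀ ≤ G.T)
    {i : I} (hdev : p.IsDeviationFrom (G.equilibriumProfile V) i) :
    p.cost i - V i t₀ s₀ = ∫ t, ∫ ω, p.penalty V i t ω ∂P ∂G.horizon t₀ := by
  rw [p.cost_sub_value_eq hden hdenBar hV h₀ h₁ i]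
  refine integral_congr_ae ?_
  filter_upwards [p.integral_hamiltonian_eq hden hdenBar (SwitchingGame.continuousOn_value hV) h₀
    hdev] with t ht using ht.2

theorem cost_eq_value (hV : G.SolvesSystem V) (h₀ : 0 ≤ t₀) (h₁ : t₀ ≤ G.T)
    (hp : p.IsPlayOf (G.equilibriumProfile V)) (i : I) : p.cost i = V i t₀ s₀ := by
  rw [← sub_eq_zero, p.cost_sub_value_eq_integral_penalty hden hdenBar hV h₀ h₁ fun j _ => hp j]
  refine integral_eq_zero_of_ae ?_
  filter_upwards [p.penalty_ae_eq_zero (hp i).1 (hp i).2] with t ht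
  exact integral_eq_zero_of_ae ht

theorem value_le_cost (hV : G.SolvesSystem V) (h₀ : 0 ≤ t₀) (h₁ : t₀ ≤ G.T) {i : I}
    (hdev : p.IsDeviationFrom (G.equilibriumProfile V) i) : V i t₀ s₀ ≤ p.cost i := by
  rw [← sub_nonneg, p.cost_sub_value_eq_integral_penalty hden hdenBar hV h₀ h₁ hdev]
  refine integral_nonneg_of_ae ?_
  filter_upwards [ae_restrict_mem measurableSet_Icc] with t ht
  exact integral_nonneg fun ω =>
    p.penalty_nonneg hden hdenBar i (Icc_subset_Icc_left h₀ ht) ω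

/-- A nonnegative penalty with zero integral vanishes for almost every `t` and then almost every
`ω`; measurability of control and feedback carries the resulting equality to the product space. -/
theorem follows_of_cost_eq_value (hV : G.SolvesSystem V) (h₀ : 0 ≤ t₀) (h₁ : t₀ ≤ G.T) {i : I}
    (hdev : p.IsDeviationFrom (G.equilibriumProfile V) i) (hcost : p.cost i = V i t₀ s₀) :
    p.Follows (G.equilibriumProfile V) i := by
  have hVc := SwitchingGame.continuousOn_value hV
  have hpen := p.integral_hamiltonian_eq hden hdenBar hVc h₀ hdev
  have hint : Integrable (fun t => ∫ ω, p.penalty V i t ω ∂P) (G.horizon t₀) :=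
    (p.integrable_hamiltonian hden hdenBar hVc h₀ i).integral_prod_left.congr
      (by filter_upwards [hpen] with t ht using ht.2)
  have hnn : 0 ≤ᵐ[G.horizon t₀] fun t => ∫ ω, p.penalty V i t ω ∂P := by
    filter_upwards [ae_restrict_mem measurableSet_Icc] with t ht
    exact integral_nonneg fun ω =>
      p.penalty_nonneg hden hdenBar i (Icc_subset_Icc_left h₀ ht) ω
  have hzero := (integral_eq_zero_iff_of_nonneg_ae hnn hint).1
    ((p.cost_sub_value_eq_integral_penalty hden hdenBar hV h₀ h₁ hdev).symm.trans
      (sub_eq_zero.2 hcost))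
  refine (p.u_meas i).aemeasurable.ae_eq_prod_of_ae_ae (p.aemeasurable_profile hVc h₀ i) ?_
  filter_upwards [hpen, hzero, ae_restrict_mem measurableSet_Icc] with t h1 h2 ht
  have ht' : t ∈ Icc 0 G.T := Icc_subset_Icc_left h₀ ht
  filter_upwards [(integral_eq_zero_iff_of_nonneg
    (fun ω => p.penalty_nonneg hden hdenBar i ht' ω) h1.1).1 h2] with ω h
  exact p.eq_profile_of_penalty_eq_zero hden hdenBar i ht' h

end Values

end Play

theorem mainTheorem8 {I S : Type*} [Fintype I] [Fintype S] [DecidableEq I]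
    (G : SwitchingGame I S)
    (hr : ∀ i, ∀ t ∈ Icc 0 G.T, ∀ x, 0 < G.r i t x)
    (hrbar : ∀ i, ∀ t ∈ Icc 0 G.T, ∀ x, 0 < G.rbar i t x)
    (V : I → ℝ → S → ℝ) (hV : G.SolvesSystem V)
    (hden : ∀ i, ∀ t ∈ Icc 0 G.T, ∀ x, 0 < G.den V i t x)
    (hdenBar : ∀ i, ∀ t ∈ Icc 0 G.T, ∀ x, 0 < G.denBar V i t x) :
    SwitchingGame.IsNashEquilibrium.{w} G (G.equilibriumProfile V) ∧
    SwitchingGame.IsCostOf.{w} G (G.equilibriumProfile V) V ∧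
    SwitchingGame.IsStrictBestResponseCost.{w} G (G.equilibriumProfile V) V := by
  refine ⟨?_, ?_, ?_⟩
  · intro i t₀ ht₀ s₀ Ω _ P _ p Ω' _ P' _ p' hp hp'
    rw [p.cost_eq_value hden hdenBar hV ht₀.1 ht₀.2 hp i]
    exact p'.value_le_cost hden hdenBar hV ht₀.1 ht₀.2 hp'
  · intro i t₀ ht₀ s₀ Ω _ P _ p hp
    exact p.cost_eq_value hden hdenBar hV ht₀.1 ht₀.2 hp i
  · intro i t₀ ht₀ s₀ Ω _ P _ p hp
    exact ⟨p.value_le_cost hden hdenBar hV ht₀.1 ht₀.2 hp,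
      p.follows_of_cost_eq_value hden hdenBar hV ht₀.1 ht₀.2 hp⟩
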